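/- Let $X$ be a separable real Hilbert space with norm $|\cdot|$. Let $\mathcal P_2(X)$ be the set of Borel probability measures $\mu$ on $X$ with $\int|x|^2\,d\mu<\infty$, with the $L^2$-Wasserstein distance $W_2$. Let $\mathcal P_2(TX)$ be the set of Borel probability measures $\Phi$ on $TX=X\times X$ with $\int(|x|^2+|v|^2)\,d\Phi(x,v)<\infty$. For $\Phi\in\mathcal P_2(TX)$ put $|\Phi|_2^2=\int|v|^2\,d\Phi(x,v)$, let $\mathsf x(x,v)=x$ and $\exp^t(x,v)=x+tv$, write $f_\sharp$ for push-forward, and for $\Phi_0,\Phi_1\in\mathcal P_2(TX)$ set $$[\Phi_0,\Phi_1]_r=\lim_{t\downarrow0}\frac{W_2^2(\exp^t_\sharp\Phi_0,\exp^t_\sharp\Phi_1)-W_2^2(\mathsf x_\sharp\Phi_0,\mathsf x_\sharp\Phi_1)}{2t}$$ (the limit always exists). Let $\lambda\in\mathbb R$ and let $\mathbf F\subset\mathcal P_2(TX)$ be a $\lambda$-dissipative multivalued probability vector field, i.e. a nonempty set such that $[\Phi_0,\Phi_1]_r\le\lambda W_2^2(\mathsf x_\sharp\Phi_0,\mathsf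 x_\sharp\Phi_1)$ for all $\Phi_0,\Phi_1\in\mathbf F$. Put $D(\mathbf F)=\{\mathsf x_\sharp\Phi:\Phi\in\mathbf F\}$ and $\mathbf F[\mu]=\{\Phi\in\mathbf F:\mathsf x_\sharp\Phi=\mu\}$. Given $\tau,T,L>0$ and $\mu_0\in D(\mathbf F)$, let $N=\lceil T/\tau\rceil$. An $L$-stable solution of the Explicit Euler scheme in $[0,T]$ with step $\tau$ starting from $\mu_0$ is a sequence $(M^n_\tau,\boldsymbol F^n_\tau)_{0\le n\le N}$ in $D(\mathbf F)\times\mathbf F$ such that $M^0_\tau=\mu_0$ and, for $0\le n<N$, $\boldsymbol F^n_\tau\in\mathbf F[M^n_\tau]$, $|\boldsymbol F^n_\tau|_2\le L$ and $M^{n+1}_\tau=\exp^\tau_\sharp\boldsymbol F^n_\tau$. Its affine interpolation is the curve $M_\tau:[0,T]\to\mathcal P_2(X)$ given by $M_\tau(t)=\exp^{t-n\tau}_\sharp\boldsymbol F^n_\tau$ for $t\in[0,T]\cap[n\tau,(n+1)\tau]$, $0\le n<N$. Let $\mathscr M(\mu_0,\tau,T,L)$ be the set of all these affine interpolations. **Proposition.**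 Let $\mu_0,\mu_0'\in D(\mathbf F)$, $M_\tau\in\mathscr M(\mu_0,\tau,T,L)$ and $M'_\tau\in\mathscr M(\mu_0',\tau,T,L)$. If $\lambda_+\tau\le2$, where $\lambda_+=\max\{\lambda,0\}$, then for every $t\in[0,T]$ $$W_2(M_\tau(t),M'_\tau(t))\le e^{\lambda t}\,W_2(\mu_0,\mu_0')+8L\sqrt{t\tau}\,\bigl(1+|\lambda|\sqrt{t\tau}\bigr)e^{\lambda_+t}.$$ -/

import Mathlib

open MeasureTheory Filter Topology
open scoped ENNReal

namespace MeasureEuler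

noncomputable section

variable {X : Type*} [NormedAddCommGroup X] [InnerProductSpace ℝ X]
  [MeasurableSpace X] [BorelSpace X] [SecondCountableTopology X]

/-- Borel probability measures on `X` with finite quadratic moment. -/
def P2 (X : Type*) [NormedAddCommGroup X] [MeasurableSpace X] : Type _ :=
  {μ : ProbabilityMeasure X // ∫⁻ x, ‖x‖ₑ ^ 2 ∂(μ : Measure X) < ∞}

/-- Borel probability measures `Φ` on the tangent bundle `TX = X × X` with
`∫ (|x|² + |v|²) dΦ(x, v) < ∞`. -/
def P2T (X : Type*) [NormedAddCommGroup X] [MeasurableSpace X] : Type _ :=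
  {Φ : ProbabilityMeasure (X × X) //
    ∫⁻ p, (‖p.1‖ₑ ^ 2 + ‖p.2‖ₑ ^ 2) ∂(Φ : Measure (X × X)) < ∞}

/-- The measure underlying an element of `P2 X`. -/
def P2.toMeasure {X : Type*} [NormedAddCommGroup X] [MeasurableSpace X] (μ : P2 X) :
    Measure X := (μ.1 : Measure X)

/-- The measure underlying an element of `P2T X`. -/
def P2T.toMeasure {X : Type*} [NormedAddCommGroup X] [MeasurableSpace X] (Φ : P2T X) :
    Measure (X × X) := (Φ.1 : Measure (X × X))

/-- The set `Γ(μ, ν)` of couplings: measures on `X × X` with marginals `μ` and `ν`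
(automatically probability measures when `μ` and `ν` are). -/
def couplings {X : Type*} [MeasurableSpace X] (μ ν : Measure X) : Set (Measure (X × X)) :=
  {γ | γ.map Prod.fst = μ ∧ γ.map Prod.snd = ν}

/-- The squared Wasserstein cost `inf {∫ |x - y|² dγ : γ ∈ Γ(μ, ν)}`; it is finite on `P2 X`. -/
def W2sq (μ ν : P2 X) : ℝ≥0∞ :=
  ⨅ γ ∈ couplings μ.toMeasure ν.toMeasure, ∫⁻ p, ‖p.1 - p.2‖ₑ ^ 2 ∂γ

/-- The `L²`-Wasserstein distance. -/
def W2 (μ ν : P2 X) : ℝ := √(W2sq μ ν).toReal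

/-- The exponential map `exp^t (x, v) = x + t v`; at `t = 0` it is the projection `(x, v) ↦ x`. -/
def expMap (t : ℝ) (p : X × X) : X := p.1 + t • p.2

theorem measurable_expMap (t : ℝ) : Measurable (expMap t : X × X → X) :=
  measurable_fst.add (measurable_snd.const_smul t)

theorem enorm_add_smul_sq_le {E : Type*} [NormedAddCommGroup E] [NormedSpace ℝ E]
    (t : ℝ) (x v : E) :
    ‖x + t • v‖ₑ ^ 2 ≤ (2 * (1 + ‖t‖ₑ ^ 2)) * (‖x‖ₑ ^ 2 + ‖v‖ₑ ^ 2) := by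
  have h1 : ‖x + t • v‖ ^ 2 ≤ (2 * (1 + ‖t‖ ^ 2)) * (‖x‖ ^ 2 + ‖v‖ ^ 2) := by
    have h2 : ‖x + t • v‖ ≤ ‖x‖ + ‖t‖ * ‖v‖ := by
      simpa [norm_smul] using norm_add_le x (t • v)
    have h3 : ‖x + t • v‖ ^ 2 ≤ (‖x‖ + ‖t‖ * ‖v‖) ^ 2 := by gcongr
    nlinarith [sq_nonneg (‖x‖ - ‖t‖ * ‖v‖), sq_nonneg (‖t‖ * ‖x‖), sq_nonneg ‖v‖]
  have h4 : ‖x + t • v‖₊ ^ 2 ≤ (2 * (1 + ‖t‖₊ ^ 2)) * (‖x‖₊ ^ 2 + ‖v‖₊ ^ 2) := by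
    exact_mod_cast h1
  simp only [enorm_eq_nnnorm]
  exact_mod_cast h4

theorem lintegral_map_expMap_lt_top (t : ℝ) (Φ : P2T X) :
    ∫⁻ x, ‖x‖ₑ ^ 2 ∂(Φ.toMeasure.map (expMap t)) < ∞ := by
  rw [lintegral_map (by fun_prop) (measurable_expMap t)]
  calc ∫⁻ p, ‖expMap t p‖ₑ ^ 2 ∂Φ.toMeasure
      ≤ ∫⁻ p, (2 * (1 + ‖t‖ₑ ^ 2)) * (‖p.1‖ₑ ^ 2 + ‖p.2‖ₑ ^ 2) ∂Φ.toMeasure :=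
        lintegral_mono fun p => enorm_add_smul_sq_le t p.1 p.2
    _ = (2 * (1 + ‖t‖ₑ ^ 2)) * ∫⁻ p, (‖p.1‖ₑ ^ 2 + ‖p.2‖ₑ ^ 2) ∂Φ.toMeasure :=
        lintegral_const_mul _ (by fun_prop)
    _ < ∞ := by
        refine ENNReal.mul_lt_top ?_ Φ.2
        simp [ENNReal.mul_lt_top_iff, enorm_eq_nnnorm]

/-- The push-forward `exp^t_♯ Φ`. -/
def expPush (t : ℝ) (Φ : P2T X) : P2 X :=
  ⟨Φ.1.map (measurable_expMap t).aemeasurable, lintegral_map_expMap_lt_top t Φ⟩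

theorem expPush_toMeasure (t : ℝ) (Φ : P2T X) :
    (expPush t Φ).toMeasure = Φ.toMeasure.map (expMap t) := rfl

theorem lintegral_map_fst_lt_top {X : Type*} [NormedAddCommGroup X] [MeasurableSpace X]
    [BorelSpace X] [SecondCountableTopology X] (Φ : P2T X) :
    ∫⁻ x, ‖x‖ₑ ^ 2 ∂(Φ.toMeasure.map Prod.fst) < ∞ := by
  rw [lintegral_map (by fun_prop) measurable_fst]
  exact (lintegral_mono fun p => le_self_add).trans_lt Φ.2

/-- The first marginal `x_♯ Φ`, the base measure of `Φ`. -/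
def base (Φ : P2T X) : P2 X :=
  ⟨Φ.1.map measurable_fst.aemeasurable, lintegral_map_fst_lt_top Φ⟩

/-- `|Φ|₂ = (∫ |v|² dΦ(x, v))^{1/2}`. -/
def vnorm (Φ : P2T X) : ℝ := √(∫⁻ p, ‖p.2‖ₑ ^ 2 ∂Φ.toMeasure).toReal

/-- The duality pairing `[Φ₀, Φ₁]_r`: the right derivative at `0` of
`t ↦ ½ W₂²(exp^t_♯ Φ₀, exp^t_♯ Φ₁)`. -/
def pairing (Φ₀ Φ₁ : P2T X) : ℝ :=
  limUnder (𝓝[>] (0 : ℝ)) fun t =>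
    (W2 (expPush t Φ₀) (expPush t Φ₁) ^ 2 - W2 (base Φ₀) (base Φ₁) ^ 2) / (2 * t)

/-- A multivalued probability vector field: a nonempty subset of `P2T X`. -/
structure MPVF (X : Type*) [NormedAddCommGroup X] [MeasurableSpace X] where
  carrier : Set (P2T X)
  nonempty : carrier.Nonempty

/-- The domain of a multivalued probability vector field. -/
def MPVF.dom (F : MPVF X) : Set (P2 X) := base '' F.carrier

/-- The section `F[μ]`. -/
def MPVF.section' (F : MPVF X) (μ : P2 X) : Set (P2T X) := {Φ ∈ F.carrier | base Φ = μ}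

/-- Metric `lam`-dissipativity. -/
def MPVF.IsDissipative (F : MPVF X) (lam : ℝ) : Prop :=
  ∀ Φ₀ ∈ F.carrier, ∀ Φ₁ ∈ F.carrier,
    pairing Φ₀ Φ₁ ≤ lam * W2 (base Φ₀) (base Φ₁) ^ 2

/-- The final step `⌈T / τ⌉`. -/
def finalStep (T τ : ℝ) : ℕ := ⌈T / τ⌉₊

/-- `(M n, Φ n)`, `0 ≤ n ≤ ⌈T / τ⌉`, is an `L`-stable solution to the explicit Euler scheme for `F`
in `[0, T]` with step `τ` starting from `μ₀`. Values with larger index play no role. -/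
structure IsEulerSolution (F : MPVF X) (μ₀ : P2 X) (τ T L : ℝ)
    (M : ℕ → P2 X) (Φ : ℕ → P2T X) : Prop where
  mem_dom : ∀ n ≤ finalStep T τ, M n ∈ F.dom
  mem_carrier : ∀ n ≤ finalStep T τ, Φ n ∈ F.carrier
  initial : M 0 = μ₀
  mem_section : ∀ n < finalStep T τ, Φ n ∈ F.section' (M n)
  stable : ∀ n < finalStep T τ, vnorm (Φ n) ≤ L
  step : ∀ n < finalStep T τ, M (n + 1) = expPush τ (Φ n)

/-- The set `ℳ(μ₀, τ, T, L)` of the affine interpolations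
`t ↦ exp^{t - nτ}_♯ Φⁿ`, `t ∈ [nτ, (n+1)τ] ∩ [0, T]`, `0 ≤ n < ⌈T / τ⌉`,
of the `L`-stable solutions of the explicit Euler scheme. -/
def eulerCurves (F : MPVF X) (μ₀ : P2 X) (τ T L : ℝ) : Set (Set.Icc (0 : ℝ) T → P2 X) :=
  {c | ∃ (M : ℕ → P2 X) (Φ : ℕ → P2T X), IsEulerSolution F μ₀ τ T L M Φ ∧
    ∀ n < finalStep T τ, ∀ t : Set.Icc (0 : ℝ) T,
      (t : ℝ) ∈ Set.Icc (n * τ) ((n + 1) * τ) → c t = expPush (t - n * τ) (Φ n)}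

end

end MeasureEuler

/-! Put `f s` for the squared distance of `expPush s Φ₀` and `expPush s Φ₁`. A coupling of `Φ₀` and
`Φ₁` has, after time `s`, a cost quadratic in `s` with leading coefficient at most `K = 2|Φ₀|₂² +
2|Φ₁|₂²`. By `exists_lift_coupling` every coupling of the pushed measures arises this way, so `f` is
the infimum of these quadratics and `f s - K s²` is concave for `s ≥ 0`. Hence the pairing exists as
a limit and `f s ≤ f 0 + 2 s [Φ₀, Φ₁]_r + K s²` (`tendsto_pairing_and_le`).

Dissipativity and `1 + x ≤ exp x` turn this into `f s ≤ exp (2λs) f 0 + 4L²s²`. Iterating over the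
steps (`gronwall_step`) bounds the squared distance at time `t` by `exp (2λt) W₂²(μ₀, μ₀') + 4L² t τ
exp (2λ₊t)`; a square root gives the claim, with 2 in place of 8. -/

open ProbabilityTheory

namespace MeasureEuler

/-! ### Infima of quadratic functions -/

section Quadratics

/-- If `f` is, for nonnegative arguments, the infimum of a family of quadratic functions whose
leading coefficients are at most `K`, then its right difference quotient at `0` converges and
`f` lies below the corresponding tangent parabola. -/
theorem exists_tendsto_slope_of_inf_quadratic {ι : Type*} {A B C : ι → ℝ} {f : ℝ → ℝ} {K : ℝ}
    (hC : ∀ i, C i ≤ K) (hB : ∀ i, 2 * B i ≤ A i + C i)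
    (hle : ∀ i, ∀ s, 0 ≤ s → f s ≤ A i + 2 * s * B i + s ^ 2 * C i)
    (hlt : ∀ s, 0 ≤ s → ∀ ε > 0, ∃ i, A i + 2 * s * B i + s ^ 2 * C i < f s + ε) :
    ∃ d : ℝ, Tendsto (fun s => (f s - f 0) / (2 * s)) (𝓝[>] 0) (𝓝 d) ∧
      ∀ s, 0 ≤ s → f s ≤ f 0 + 2 * s * d + K * s ^ 2 := by
  set h : ℝ → ℝ := fun s => (f s - K * s ^ 2 - f 0) / s with hh
  have hA : ∀ i, f 0 ≤ A i := fun i => by simpa using hle i 0 le_rfl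
  -- Chord slopes from 0 of a concave function decrease: an index nearly optimal at `s` is tested at
  -- `t` and at 0.
  have anti : AntitoneOn h (Set.Ioi 0) := by
    intro s hs t ht hst
    rw [Set.mem_Ioi] at hs ht
    simp only [hh]
    rw [div_le_div_iff₀ ht hs]
    refine le_of_forall_pos_le_add fun ε hε => ?_
    obtain ⟨i, hi⟩ := hlt s hs.le (ε / t) (by positivity)
    have h1 := hle i t ht.le
    have h2 : 0 ≤ (t - s) * (A i - f 0) := mul_nonneg (by linarith) (by linarith [hA i])
    have h3 : 0 ≤ s * t * ((t - s) * (K - C i)) :=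
      mul_nonneg (by positivity) (mul_nonneg (by linarith) (by linarith [hC i]))
    have h4 : t * (A i + 2 * s * B i + s ^ 2 * C i) ≤ t * f s + ε := by
      have := mul_le_mul_of_nonneg_left hi.le ht.le
      rwa [mul_add t (f s), mul_div_cancel₀ _ ht.ne'] at this
    have h5 := mul_le_mul_of_nonneg_left h1 hs.le
    linarith
  have bdd : BddAbove (h '' Set.Ioi 0) := by
    refine ⟨f 0 + 1 + K, ?_⟩
    rintro _ ⟨s, hs, rfl⟩
    rw [Set.mem_Ioi] at hs
    simp only [hh]
    rw [div_le_iff₀ hs]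
    refine le_of_forall_pos_le_add fun ε hε => ?_
    -- The cap 1 bounds `A i`, hence `B i` through `hB`, independently of `ε`.
    obtain ⟨i, hi⟩ := hlt 0 le_rfl (min ε 1) (by positivity)
    have h1 := hle i s hs.le
    have h2 : s * (2 * B i) ≤ s * (f 0 + 1 + K) :=
      mul_le_mul_of_nonneg_left (by linarith [hB i, hC i, min_le_right ε 1]) hs.le
    have h3 : s ^ 2 * C i ≤ s ^ 2 * K := mul_le_mul_of_nonneg_left (hC i) (sq_nonneg s)
    linarith [min_le_left ε 1]
  have lim : Tendsto h (𝓝[>] 0) (𝓝 (sSup (h '' Set.Ioi 0))) :=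
    anti.tendsto_nhdsGT bdd
  refine ⟨sSup (h '' Set.Ioi 0) / 2, ?_, fun s hs => ?_⟩
  · have h0 : Tendsto (fun s : ℝ => h s / 2 + K * s / 2) (𝓝[>] 0)
        (𝓝 (sSup (h '' Set.Ioi 0) / 2 + K * 0 / 2)) :=
      (lim.div_const 2).add (((tendsto_id.mono_left nhdsWithin_le_nhds).const_mul K).div_const 2)
    rw [mul_zero, zero_div, add_zero] at h0
    refine h0.congr' ?_
    filter_upwards [self_mem_nhdsWithin] with s hs
    have : s ≠ 0 := (Set.mem_Ioi.1 hs).ne'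
    simp only [hh]
    field_simp
    ring
  · rcases hs.eq_or_lt with rfl | hs
    · simp
    · have h1 : h s ≤ sSup (h '' Set.Ioi 0) := le_csSup bdd ⟨s, hs, rfl⟩
      simp only [hh] at h1 ⊢
      rw [div_le_iff₀ hs] at h1
      linarith

end Quadratics

/-! ### Lifting couplings along a map -/

section Couplings

theorem isFiniteMeasure_of_mem_couplings {A : Type*} [MeasurableSpace A] {μ ν : Measure A}
    [IsFiniteMeasure μ] {γ : Measure (A × A)} (hγ : γ ∈ couplings μ ν) : IsFiniteMeasure γ := by
  refine ⟨?_⟩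
  have : γ Set.univ = μ Set.univ := by
    rw [← hγ.1, Measure.map_apply measurable_fst MeasurableSet.univ, Set.preimage_univ]
  rw [this]
  exact measure_lt_top μ _

/-- A measure on `B × Y` whose first marginal is `μ.map π` lifts along `π` to a measure on
`A × Y` with first marginal `μ`. -/
theorem exists_lift_fst {A B Y : Type*} [MeasurableSpace A] [MeasurableSpace B]
    [MeasurableSpace Y] [StandardBorelSpace Y] [Nonempty Y] {μ : Measure A} [IsFiniteMeasure μ]
    {π : A → B} (hπ : Measurable π) {γ : Measure (B × Y)} [IsFiniteMeasure γ]
    (hγ : γ.map Prod.fst = μ.map π) :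
    ∃ σ : Measure (A × Y), IsFiniteMeasure σ ∧ σ.map Prod.fst = μ ∧
      σ.map (Prod.map π id) = γ := by
  -- Draw `a` from `μ`, then `y` from the conditional law of `γ` at `π a`.
  refine ⟨μ ⊗ₘ γ.condKernel.comap π hπ, inferInstance, ?_, ?_⟩
  · exact Measure.fst_compProd _ _
  · conv_rhs => rw [← γ.disintegrate γ.condKernel]
    ext s hs
    rw [Measure.map_apply (hπ.prodMap measurable_id) hs,
      Measure.compProd_apply ((hπ.prodMap measurable_id) hs), Measure.compProd_apply hs,
      Measure.fst, hγ, lintegral_map (Kernel.measurable_kernel_prodMk_left hs) hπ]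
    rfl

/-- Couplings of push-forwards lift to couplings. -/
theorem exists_lift_coupling {A B : Type*} [MeasurableSpace A] [StandardBorelSpace A]
    [MeasurableSpace B] [StandardBorelSpace B] [Nonempty A] [Nonempty B]
    {μ ν : Measure A} [IsFiniteMeasure μ] [IsFiniteMeasure ν]
    {π : A → B} (hπ : Measurable π) {γ : Measure (B × B)}
    (hγ : γ ∈ couplings (μ.map π) (ν.map π)) :
    ∃ σ ∈ couplings μ ν, σ.map (Prod.map π π) = γ := by
  have := isFiniteMeasure_of_mem_couplings hγ
  -- The coordinates are lifted one at a time, with a swap in between.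
  obtain ⟨σ₁, h1, h1f, h1m⟩ := exists_lift_fst hπ hγ.1
  have h2 : (σ₁.map Prod.swap).map Prod.fst = ν.map π := by
    rw [Measure.map_map measurable_fst measurable_swap, ← hγ.2, ← h1m,
      Measure.map_map measurable_snd (hπ.prodMap measurable_id)]
    rfl
  obtain ⟨σ₂, h2, h2f, h2m⟩ := exists_lift_fst hπ h2
  refine ⟨σ₂.map Prod.swap, ⟨?_, ?_⟩, ?_⟩
  · rw [Measure.map_map measurable_fst measurable_swap, ← h1f]
    have : σ₁ = (σ₂.map (Prod.map π id)).map Prod.swap := by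
      rw [h2m, Measure.map_map measurable_swap measurable_swap]
      simp
    rw [this, Measure.map_map measurable_swap (hπ.prodMap measurable_id),
      Measure.map_map measurable_fst (measurable_swap.comp (hπ.prodMap measurable_id))]
    rfl
  · rw [Measure.map_map measurable_snd measurable_swap, ← h2f]
    rfl
  · have : σ₁ = (σ₂.map (Prod.map π id)).map Prod.swap := by
      rw [h2m, Measure.map_map measurable_swap measurable_swap]
      simp
    rw [← h1m, this, Measure.map_map measurable_swap (hπ.prodMap measurable_id),
      Measure.map_map (hπ.prodMap measurable_id)
        (measurable_swap.comp (hπ.prodMap measurable_id)),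
      Measure.map_map (hπ.prodMap hπ) measurable_swap]
    rfl

theorem prod_mem_couplings {A : Type*} [MeasurableSpace A] (μ ν : Measure A)
    [IsProbabilityMeasure μ] [IsProbabilityMeasure ν] : μ.prod ν ∈ couplings μ ν := by
  constructor <;> simp [Measure.map_fst_prod, Measure.map_snd_prod]

end Couplings

section Basic

variable {X : Type*} [NormedAddCommGroup X] [MeasurableSpace X]

instance (μ : P2 X) : IsProbabilityMeasure μ.toMeasure := by
  unfold P2.toMeasure; infer_instance

instance (Φ : P2T X) : IsProbabilityMeasure Φ.toMeasure := by
  unfold P2T.toMeasure; infer_instance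

theorem W2_nonneg (μ ν : P2 X) : 0 ≤ W2 μ ν := Real.sqrt_nonneg _

theorem W2_sq (μ ν : P2 X) : W2 μ ν ^ 2 = (W2sq μ ν).toReal :=
  Real.sq_sqrt ENNReal.toReal_nonneg

variable {Φ₀ Φ₁ : P2T X} {σ : Measure ((X × X) × (X × X))}

theorem memLp_comp_fst_of_mem_couplings (hσ : σ ∈ couplings Φ₀.toMeasure Φ₁.toMeasure)
    {g : X × X → X} (hg : MemLp g 2 Φ₀.toMeasure) : MemLp (fun p => g p.1) 2 σ := by
  rw [← hσ.1] at hg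
  exact hg.comp_of_map measurable_fst.aemeasurable

theorem memLp_comp_snd_of_mem_couplings (hσ : σ ∈ couplings Φ₀.toMeasure Φ₁.toMeasure)
    {g : X × X → X} (hg : MemLp g 2 Φ₁.toMeasure) : MemLp (fun p => g p.2) 2 σ := by
  rw [← hσ.2] at hg
  exact hg.comp_of_map measurable_snd.aemeasurable

end Basic

/-! ### Square-integrable maps and quadratic costs -/

section SquareIntegrable

theorem integral_norm_sq_eq_toReal {A E : Type*} [NormedAddCommGroup E] [MeasurableSpace A]
    {σ : Measure A} {u : A → E}
    (hu : AEStronglyMeasurable u σ) :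
    ∫ p, ‖u p‖ ^ 2 ∂σ = (∫⁻ p, ‖u p‖ₑ ^ 2 ∂σ).toReal := by
  rw [integral_eq_lintegral_of_nonneg_ae (ae_of_all _ fun p => by positivity) (by fun_prop)]
  congr 1
  refine lintegral_congr fun p => ?_
  rw [ENNReal.ofReal_pow (norm_nonneg _), ofReal_norm]

theorem memLp_two_of_lintegral {A E : Type*} [NormedAddCommGroup E] [MeasurableSpace A]
    {σ : Measure A} {u : A → E}
    (hu : AEStronglyMeasurable u σ) (h : ∫⁻ p, ‖u p‖ₑ ^ 2 ∂σ < ∞) : MemLp u 2 σ := by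
  rw [memLp_two_iff_integrable_sq_norm hu]
  refine ⟨by fun_prop, ?_⟩
  simpa [HasFiniteIntegral, enorm_pow] using h

/-- The squared `L²` norm along a line in `L²` is a quadratic function. -/
theorem integral_norm_add_smul_sq {A E : Type*} [NormedAddCommGroup E]
    [InnerProductSpace ℝ E] [MeasurableSpace A] {σ : Measure A} {u w : A → E}
    (hu : MemLp u 2 σ) (hw : MemLp w 2 σ) (s : ℝ) :
    ∫ p, ‖u p + s • w p‖ ^ 2 ∂σ =
      ∫ p, ‖u p‖ ^ 2 ∂σ + 2 * s * ∫ p, inner ℝ (u p) (w p) ∂σ + s ^ 2 * ∫ p, ‖w p‖ ^ 2 ∂σ := by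
  have h1 := hu.integrable_norm_pow two_ne_zero
  have h2 := hw.integrable_norm_pow two_ne_zero
  have h3 : Integrable (fun p => inner ℝ (u p) (w p)) σ := by
    refine (h1.add h2).mono' (hu.1.inner hw.1) (ae_of_all _ fun p => ?_)
    have := norm_inner_le_norm (𝕜 := ℝ) (u p) (w p)
    simp only [Pi.add_apply]
    nlinarith [sq_nonneg (‖u p‖ - ‖w p‖), sq_nonneg (‖u p‖ + ‖w p‖)]
  rw [← integral_const_mul, ← integral_const_mul, ← integral_add h1 (h3.const_mul _),
    ← integral_add (by exact h1.add (h3.const_mul _)) (h2.const_mul _)]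
  refine integral_congr_ae (ae_of_all _ fun p => ?_)
  beta_reduce
  rw [norm_add_sq_real, inner_smul_right, norm_smul, mul_pow, Real.norm_eq_abs, sq_abs]
  ring

theorem two_mul_integral_inner_le {A E : Type*} [NormedAddCommGroup E]
    [InnerProductSpace ℝ E] [MeasurableSpace A] {σ : Measure A} {u w : A → E}
    (hu : MemLp u 2 σ) (hw : MemLp w 2 σ) :
    2 * ∫ p, inner ℝ (u p) (w p) ∂σ ≤ ∫ p, ‖u p‖ ^ 2 ∂σ + ∫ p, ‖w p‖ ^ 2 ∂σ := by
  have h := integral_norm_add_smul_sq hu hw (-1)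
  have h0 : 0 ≤ ∫ p, ‖u p + (-1 : ℝ) • w p‖ ^ 2 ∂σ := integral_nonneg fun p => by positivity
  linarith

theorem integral_norm_sub_sq_le {A E : Type*} [NormedAddCommGroup E]
    [InnerProductSpace ℝ E] [MeasurableSpace A] {σ : Measure A} {u w : A → E}
    (hu : MemLp u 2 σ) (hw : MemLp w 2 σ) :
    ∫ p, ‖u p - w p‖ ^ 2 ∂σ ≤ 2 * ∫ p, ‖u p‖ ^ 2 ∂σ + 2 * ∫ p, ‖w p‖ ^ 2 ∂σ := by
  -- Parallelogram identity: the cross terms at -1 and 1 cancel.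
  have h1 := integral_norm_add_smul_sq hu hw (-1)
  have h2 := integral_norm_add_smul_sq hu hw 1
  have h0 : 0 ≤ ∫ p, ‖u p + (1 : ℝ) • w p‖ ^ 2 ∂σ := integral_nonneg fun p => by positivity
  simp only [neg_smul, one_smul, ← sub_eq_add_neg] at h1 h2 h0
  linarith

variable {X : Type*} [NormedAddCommGroup X] [MeasurableSpace X] [BorelSpace X]
  [SecondCountableTopology X]

theorem memLp_fst (Φ : P2T X) : MemLp (fun p : X × X => p.1) 2 Φ.toMeasure :=
  memLp_two_of_lintegral (by fun_prop) ((lintegral_mono fun _ => le_self_add).trans_lt Φ.2)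

theorem memLp_snd (Φ : P2T X) : MemLp (fun p : X × X => p.2) 2 Φ.toMeasure :=
  memLp_two_of_lintegral (by fun_prop) ((lintegral_mono fun _ => le_add_self).trans_lt Φ.2)

theorem vnorm_sq (Φ : P2T X) : vnorm Φ ^ 2 = ∫ p, ‖p.2‖ ^ 2 ∂Φ.toMeasure := by
  rw [vnorm, Real.sq_sqrt ENNReal.toReal_nonneg, integral_norm_sq_eq_toReal (by fun_prop)]

variable {Φ₀ Φ₁ : P2T X} {σ : Measure ((X × X) × (X × X))}

theorem memLp_position_sub (hσ : σ ∈ couplings Φ₀.toMeasure Φ₁.toMeasure) :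
    MemLp (fun p => p.1.1 - p.2.1) 2 σ :=
  (memLp_comp_fst_of_mem_couplings hσ (memLp_fst Φ₀)).sub
    (memLp_comp_snd_of_mem_couplings hσ (memLp_fst Φ₁))

theorem memLp_velocity_sub (hσ : σ ∈ couplings Φ₀.toMeasure Φ₁.toMeasure) :
    MemLp (fun p => p.1.2 - p.2.2) 2 σ :=
  (memLp_comp_fst_of_mem_couplings hσ (memLp_snd Φ₀)).sub
    (memLp_comp_snd_of_mem_couplings hσ (memLp_snd Φ₁))

end SquareIntegrable

variable {X : Type*} [NormedAddCommGroup X] [InnerProductSpace ℝ X]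
  [MeasurableSpace X] [BorelSpace X] [SecondCountableTopology X]

theorem base_eq_expPush_zero (Φ : P2T X) : base Φ = expPush 0 Φ := by
  have h : (expMap 0 : X × X → X) = Prod.fst := by
    ext p
    simp [expMap]
  apply Subtype.ext
  apply Subtype.ext
  change Φ.toMeasure.map Prod.fst = Φ.toMeasure.map (expMap 0)
  rw [h]

/-! ### Transport cost of a coupling moved along its velocities -/

section Couplings

variable {Φ₀ Φ₁ : P2T X} {σ : Measure ((X × X) × (X × X))}

theorem integral_velocity_sub_sq_le (hσ : σ ∈ couplings Φ₀.toMeasure Φ₁.toMeasure) :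
    ∫ p, ‖p.1.2 - p.2.2‖ ^ 2 ∂σ ≤ 2 * vnorm Φ₀ ^ 2 + 2 * vnorm Φ₁ ^ 2 := by
  have h1 : ∫ p, ‖p.1.2‖ ^ 2 ∂σ = vnorm Φ₀ ^ 2 := by
    rw [vnorm_sq, ← hσ.1, integral_map (by fun_prop) (by fun_prop)]
  have h2 : ∫ p, ‖p.2.2‖ ^ 2 ∂σ = vnorm Φ₁ ^ 2 := by
    rw [vnorm_sq, ← hσ.2, integral_map (by fun_prop) (by fun_prop)]
  rw [← h1, ← h2]
  exact integral_norm_sub_sq_le (memLp_comp_fst_of_mem_couplings hσ (memLp_snd Φ₀))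
    (memLp_comp_snd_of_mem_couplings hσ (memLp_snd Φ₁))

theorem map_mem_couplings (hσ : σ ∈ couplings Φ₀.toMeasure Φ₁.toMeasure) (s : ℝ) :
    σ.map (Prod.map (expMap s) (expMap s)) ∈
      couplings (expPush s Φ₀).toMeasure (expPush s Φ₁).toMeasure := by
  have hm := (measurable_expMap (X := X) s).prodMap (measurable_expMap (X := X) s)
  rw [expPush_toMeasure, expPush_toMeasure, ← hσ.1, ← hσ.2]
  constructor
  · rw [Measure.map_map measurable_fst hm, Measure.map_map (measurable_expMap s) measurable_fst]
    rfl
  · rw [Measure.map_map measurable_snd hm, Measure.map_map (measurable_expMap s) measurable_snd]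
    rfl

theorem lintegral_map_expMap (s : ℝ) :
    ∫⁻ p, ‖p.1 - p.2‖ₑ ^ 2 ∂(σ.map (Prod.map (expMap s) (expMap s))) =
      ∫⁻ p, ‖(p.1.1 - p.2.1) + s • (p.1.2 - p.2.2)‖ₑ ^ 2 ∂σ := by
  rw [lintegral_map (by fun_prop)
    ((measurable_expMap (X := X) s).prodMap (measurable_expMap (X := X) s))]
  refine lintegral_congr fun p => ?_
  simp only [Prod.map_fst, Prod.map_snd, expMap]
  congr 2
  rw [smul_sub]
  abel

theorem lintegral_transport_lt_top (hσ : σ ∈ couplings Φ₀.toMeasure Φ₁.toMeasure) (s : ℝ) :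
    ∫⁻ p, ‖(p.1.1 - p.2.1) + s • (p.1.2 - p.2.2)‖ₑ ^ 2 ∂σ < ∞ := by
  have h := (((memLp_position_sub hσ).add
    ((memLp_velocity_sub hσ).const_smul s)).integrable_norm_pow two_ne_zero).2
  simpa [HasFiniteIntegral, enorm_pow] using h

theorem toReal_lintegral_transport (hσ : σ ∈ couplings Φ₀.toMeasure Φ₁.toMeasure) (s : ℝ) :
    (∫⁻ p, ‖(p.1.1 - p.2.1) + s • (p.1.2 - p.2.2)‖ₑ ^ 2 ∂σ).toReal =
      ∫ p, ‖p.1.1 - p.2.1‖ ^ 2 ∂σ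
        + 2 * s * ∫ p, inner ℝ (p.1.1 - p.2.1) (p.1.2 - p.2.2) ∂σ
        + s ^ 2 * ∫ p, ‖p.1.2 - p.2.2‖ ^ 2 ∂σ := by
  rw [← integral_norm_add_smul_sq (memLp_position_sub hσ) (memLp_velocity_sub hσ),
    integral_norm_sq_eq_toReal (by fun_prop)]

theorem W2sq_expPush_le (hσ : σ ∈ couplings Φ₀.toMeasure Φ₁.toMeasure) (s : ℝ) :
    W2sq (expPush s Φ₀) (expPush s Φ₁) ≤
      ∫⁻ p, ‖(p.1.1 - p.2.1) + s • (p.1.2 - p.2.2)‖ₑ ^ 2 ∂σ :=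
  (iInf₂_le _ (map_mem_couplings hσ s)).trans_eq (lintegral_map_expMap s)

end Couplings

/-! ### Tangent parabola and dissipativity -/

section Evolution

variable [CompleteSpace X]

/-- Lifting a nearly optimal coupling of the pushed measures is what needs `X` complete, hence
standard Borel. -/
theorem exists_coupling_lintegral_lt (Φ₀ Φ₁ : P2T X) (s : ℝ) {c : ℝ≥0∞}
    (hc : W2sq (expPush s Φ₀) (expPush s Φ₁) < c) :
    ∃ σ ∈ couplings Φ₀.toMeasure Φ₁.toMeasure,
      ∫⁻ p, ‖(p.1.1 - p.2.1) + s • (p.1.2 - p.2.2)‖ₑ ^ 2 ∂σ < c := by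
  simp only [W2sq, iInf_lt_iff] at hc
  obtain ⟨γ, hγ, h⟩ := hc
  obtain ⟨σ, hσ, rfl⟩ := exists_lift_coupling (measurable_expMap s) hγ
  exact ⟨σ, hσ, by rwa [← lintegral_map_expMap]⟩

/-- The limit defining the duality pairing exists, and the squared Wasserstein distance along
the exponential flows lies below the tangent parabola it determines. -/
theorem tendsto_pairing_and_le (Φ₀ Φ₁ : P2T X) :
    Tendsto (fun t => (W2 (expPush t Φ₀) (expPush t Φ₁) ^ 2 - W2 (base Φ₀) (base Φ₁) ^ 2) /
      (2 * t)) (𝓝[>] 0) (𝓝 (pairing Φ₀ Φ₁)) ∧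
    ∀ s, 0 ≤ s → W2 (expPush s Φ₀) (expPush s Φ₁) ^ 2 ≤ W2 (base Φ₀) (base Φ₁) ^ 2
      + 2 * s * pairing Φ₀ Φ₁ + (2 * vnorm Φ₀ ^ 2 + 2 * vnorm Φ₁ ^ 2) * s ^ 2 := by
  have key := exists_tendsto_slope_of_inf_quadratic
    (ι := couplings Φ₀.toMeasure Φ₁.toMeasure)
    (A := fun σ => ∫ p, ‖p.1.1 - p.2.1‖ ^ 2 ∂σ.1)
    (B := fun σ => ∫ p, inner ℝ (p.1.1 - p.2.1) (p.1.2 - p.2.2) ∂σ.1)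
    (C := fun σ => ∫ p, ‖p.1.2 - p.2.2‖ ^ 2 ∂σ.1)
    (f := fun s => W2 (expPush s Φ₀) (expPush s Φ₁) ^ 2)
    (K := 2 * vnorm Φ₀ ^ 2 + 2 * vnorm Φ₁ ^ 2)
    (fun σ => integral_velocity_sub_sq_le σ.2)
    (fun σ => two_mul_integral_inner_le (memLp_position_sub σ.2) (memLp_velocity_sub σ.2))
    (fun σ s _ => by
      rw [← toReal_lintegral_transport σ.2, W2_sq]
      exact ENNReal.toReal_mono (lintegral_transport_lt_top σ.2 s).ne (W2sq_expPush_le σ.2 s))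
    (fun s _ ε hε => by
      -- The product coupling has finite cost.
      have hfin : W2sq (expPush s Φ₀) (expPush s Φ₁) ≠ ∞ :=
        ((W2sq_expPush_le (prod_mem_couplings _ _) s).trans_lt
          (lintegral_transport_lt_top (prod_mem_couplings _ _) s)).ne
      obtain ⟨σ, hσ, h⟩ := exists_coupling_lintegral_lt Φ₀ Φ₁ s
        (ENNReal.lt_add_right hfin (ENNReal.ofReal_pos.2 hε).ne')
      refine ⟨⟨σ, hσ⟩, ?_⟩
      rw [← toReal_lintegral_transport hσ, W2_sq]
      have := ENNReal.toReal_strict_mono (by finiteness) h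
      rwa [ENNReal.toReal_add hfin ENNReal.ofReal_ne_top, ENNReal.toReal_ofReal hε.le] at this)
  obtain ⟨d, hd, hle⟩ := key
  simp only [← base_eq_expPush_zero] at hd hle
  -- `limUnder` is meaningful only now that convergence is known.
  have hp : pairing Φ₀ Φ₁ = d := hd.limUnder_eq
  rw [hp]
  exact ⟨hd, hle⟩

theorem W2_expPush_sq_le {F : MPVF X} {lam L : ℝ} (hF : F.IsDissipative lam)
    {Φ₀ Φ₁ : P2T X} (h₀ : Φ₀ ∈ F.carrier) (h₁ : Φ₁ ∈ F.carrier)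
    (hL₀ : vnorm Φ₀ ≤ L) (hL₁ : vnorm Φ₁ ≤ L) {s : ℝ} (hs : 0 ≤ s) :
    W2 (expPush s Φ₀) (expPush s Φ₁) ^ 2 ≤
      Real.exp (2 * lam * s) * W2 (base Φ₀) (base Φ₁) ^ 2 + 4 * L ^ 2 * s ^ 2 := by
  have h := (tendsto_pairing_and_le Φ₀ Φ₁).2 s hs
  have h1 := mul_le_mul_of_nonneg_left (hF Φ₀ h₀ Φ₁ h₁) (show 0 ≤ 2 * s by positivity)
  have h2 : vnorm Φ₀ ^ 2 ≤ L ^ 2 := pow_le_pow_left₀ (Real.sqrt_nonneg _) hL₀ 2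
  have h3 : vnorm Φ₁ ^ 2 ≤ L ^ 2 := pow_le_pow_left₀ (Real.sqrt_nonneg _) hL₁ 2
  have h4 : (2 * vnorm Φ₀ ^ 2 + 2 * vnorm Φ₁ ^ 2) * s ^ 2 ≤ 4 * L ^ 2 * s ^ 2 :=
    mul_le_mul_of_nonneg_right (by linarith) (sq_nonneg s)
  have h5 := mul_le_mul_of_nonneg_right (Real.add_one_le_exp (2 * lam * s))
    (sq_nonneg (W2 (base Φ₀) (base Φ₁)))
  linarith

/-! ### Discrete Gronwall estimate along the scheme -/

/-- One step of the discrete Gronwall argument. -/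
theorem gronwall_step {lam τ L a b w r s : ℝ} (hr : 0 ≤ r) (hs : 0 ≤ s) (hsτ : s ≤ τ)
    (ha : a ≤ Real.exp (2 * lam * r) * w + 4 * L ^ 2 * (r * τ) * Real.exp (2 * max lam 0 * r))
    (hb : b ≤ Real.exp (2 * lam * s) * a + 4 * L ^ 2 * s ^ 2) :
    b ≤ Real.exp (2 * lam * (r + s)) * w
      + 4 * L ^ 2 * ((r + s) * τ) * Real.exp (2 * max lam 0 * (r + s)) := by
  have hτ : 0 ≤ τ := hs.trans hsτ
  have h1 := mul_le_mul_of_nonneg_left ha (Real.exp_pos (2 * lam * s)).le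
  have e1 : Real.exp (2 * lam * (r + s)) = Real.exp (2 * lam * s) * Real.exp (2 * lam * r) := by
    rw [← Real.exp_add]
    ring_nf
  have e2 : Real.exp (2 * max lam 0 * (r + s)) =
      Real.exp (2 * max lam 0 * s) * Real.exp (2 * max lam 0 * r) := by
    rw [← Real.exp_add]
    ring_nf
  have h2 : Real.exp (2 * lam * s) ≤ Real.exp (2 * max lam 0 * s) := by
    gcongr
    exact le_max_left _ _
  have h3 : 4 * L ^ 2 * (r * τ) * (Real.exp (2 * lam * s) * Real.exp (2 * max lam 0 * r)) ≤
      4 * L ^ 2 * (r * τ) * Real.exp (2 * max lam 0 * (r + s)) := by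
    rw [e2]
    gcongr
  have h4 : (1 : ℝ) ≤ Real.exp (2 * max lam 0 * (r + s)) :=
    Real.one_le_exp (by have := le_max_right lam 0; positivity)
  -- Since `s² ≤ s τ`, the errors add up linearly in time, for full and partial steps alike. The
  -- fresh error has no decay factor, whence `λ₊`.
  have h5 : 4 * L ^ 2 * s ^ 2 ≤ 4 * L ^ 2 * (s * τ) * Real.exp (2 * max lam 0 * (r + s)) := by
    calc 4 * L ^ 2 * s ^ 2 ≤ 4 * L ^ 2 * (s * τ) * 1 := by
          rw [mul_one, sq s]
          gcongr
      _ ≤ _ := by gcongr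
  rw [e1]
  linarith

variable {F : MPVF X} {lam τ T L : ℝ} {μ₀ μ₀' : P2 X} {M M' : ℕ → P2 X} {Φ Φ' : ℕ → P2T X}

theorem IsEulerSolution.W2_expPush_sq_le (hF : F.IsDissipative lam)
    (h : IsEulerSolution F μ₀ τ T L M Φ) (h' : IsEulerSolution F μ₀' τ T L M' Φ')
    {n : ℕ} (hn : n < finalStep T τ) {s : ℝ} (hs : 0 ≤ s) :
    W2 (expPush s (Φ n)) (expPush s (Φ' n)) ^ 2 ≤
      Real.exp (2 * lam * s) * W2 (M n) (M' n) ^ 2 + 4 * L ^ 2 * s ^ 2 := by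
  have := MeasureEuler.W2_expPush_sq_le hF (h.mem_section n hn).1 (h'.mem_section n hn).1
    (h.stable n hn) (h'.stable n hn) hs
  rwa [(h.mem_section n hn).2, (h'.mem_section n hn).2] at this

theorem IsEulerSolution.W2_sq_le (hF : F.IsDissipative lam) (hτ : 0 ≤ τ)
    (h : IsEulerSolution F μ₀ τ T L M Φ) (h' : IsEulerSolution F μ₀' τ T L M' Φ')
    {n : ℕ} (hn : n ≤ finalStep T τ) :
    W2 (M n) (M' n) ^ 2 ≤ Real.exp (2 * lam * (n * τ)) * W2 μ₀ μ₀' ^ 2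
      + 4 * L ^ 2 * ((n * τ) * τ) * Real.exp (2 * max lam 0 * (n * τ)) := by
  induction n with
  | zero => simp [h.initial, h'.initial]
  | succ n ih =>
    have hn' : n < finalStep T τ := hn
    rw [h.step n hn', h'.step n hn', Nat.cast_succ, add_one_mul]
    exact gronwall_step (by positivity) hτ le_rfl (ih hn'.le)
      (h.W2_expPush_sq_le hF h' hn' hτ)

theorem exists_step_mem_Icc (hτ : 0 < τ) (hT : 0 < T) {t : ℝ} (ht : t ∈ Set.Icc 0 T) :
    ∃ n < finalStep T τ, t ∈ Set.Icc (n * τ) ((n + 1) * τ) := by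
  rcases ht.1.eq_or_lt with h0 | h0
  · exact ⟨0, Nat.ceil_pos.2 (by positivity), by simp [← h0, hτ.le]⟩
  -- Taking `n = ⌈t / τ⌉ - 1` rather than a floor keeps `n` below the final step even at `t = T`.
  · have hpos : 0 < ⌈t / τ⌉₊ := Nat.ceil_pos.2 (by positivity)
    obtain ⟨n, hn⟩ := Nat.exists_eq_succ_of_ne_zero hpos.ne'
    have h1 : (n : ℝ) < t / τ := Nat.lt_ceil.1 (by omega)
    have h2 : t / τ ≤ (n : ℝ) + 1 := by
      have := Nat.le_ceil (t / τ)
      rw [hn] at this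
      exact_mod_cast this
    refine ⟨n, ?_, ((lt_div_iff₀ hτ).1 h1).le, (div_le_iff₀ hτ).1 h2⟩
    have h3 : ⌈t / τ⌉₊ ≤ ⌈T / τ⌉₊ := Nat.ceil_mono (by gcongr; exact ht.2)
    unfold finalStep
    omega

/-- The squared distance of two affine interpolations. -/
theorem W2_sq_le_of_mem_eulerCurves (hF : F.IsDissipative lam) (hτ : 0 < τ) (hT : 0 < T)
    {c c' : Set.Icc (0 : ℝ) T → P2 X} (hc : c ∈ eulerCurves F μ₀ τ T L)
    (hc' : c' ∈ eulerCurves F μ₀' τ T L) (t : Set.Icc (0 : ℝ) T) :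
    W2 (c t) (c' t) ^ 2 ≤ Real.exp (2 * lam * t) * W2 μ₀ μ₀' ^ 2
      + 4 * L ^ 2 * (t * τ) * Real.exp (2 * max lam 0 * t) := by
  obtain ⟨M, Φ, h, hcM⟩ := hc
  obtain ⟨M', Φ', h', hcM'⟩ := hc'
  obtain ⟨n, hn, ht⟩ := exists_step_mem_Icc hτ hT t.2
  rw [hcM n hn t ht, hcM' n hn t ht]
  have hs : 0 ≤ (t : ℝ) - n * τ := sub_nonneg.2 ht.1
  have := gronwall_step (by positivity) hs (by linarith [ht.2])
    (h.W2_sq_le hF hτ.le h' hn.le) (h.W2_expPush_sq_le hF h' hn hs)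
  rwa [add_sub_cancel] at this

end Evolution

end MeasureEuler

theorem mainTheorem7 {X : Type*} [NormedAddCommGroup X] [InnerProductSpace ℝ X] [CompleteSpace X]
    [SecondCountableTopology X] [MeasurableSpace X] [BorelSpace X]
    (F : MeasureEuler.MPVF X) (lam : ℝ) (hF : F.IsDissipative lam)
    (τ T L : ℝ) (hτ : 0 < τ) (hT : 0 < T) (hL : 0 < L)
    (μ₀ μ₀' : MeasureEuler.P2 X) (M M' : Set.Icc (0 : ℝ) T → MeasureEuler.P2 X)
    (hM : M ∈ MeasureEuler.eulerCurves F μ₀ τ T L)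
    (hM' : M' ∈ MeasureEuler.eulerCurves F μ₀' τ T L)
    (hstep : max lam 0 * τ ≤ 2) (t : Set.Icc (0 : ℝ) T) :
    MeasureEuler.W2 (M t) (M' t) ≤
      MeasureEuler.W2 μ₀ μ₀' * Real.exp (lam * t)
        + 8 * L * √(t * τ) * (1 + |lam| * √(t * τ)) * Real.exp (max lam 0 * t) := by
  have h := MeasureEuler.W2_sq_le_of_mem_eulerCurves hF hτ hT hM hM' t
  have ht : 0 ≤ (t : ℝ) * τ := mul_nonneg t.2.1 hτ.le
  have ha : 0 ≤ MeasureEuler.W2 μ₀ μ₀' * Real.exp (lam * t) :=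
    mul_nonneg (MeasureEuler.W2_nonneg _ _) (Real.exp_pos _).le
  have hb : 0 ≤ 2 * L * √(t * τ) * Real.exp (max lam 0 * t) := by positivity
  have e (c : ℝ) : Real.exp (2 * c * t) = Real.exp (c * t) ^ 2 := by
    rw [← Real.exp_nat_mul]
    push_cast
    ring_nf
  have h1 : MeasureEuler.W2 (M t) (M' t) ≤ MeasureEuler.W2 μ₀ μ₀' * Real.exp (lam * t)
      + 2 * L * √(t * τ) * Real.exp (max lam 0 * t) := by
    -- The bound has the form `a² + b²`, which is at most `(a + b)²` for `a, b ≥ 0`.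
    refine le_of_sq_le_sq ?_ (add_nonneg ha hb)
    have hsq : (2 * L * √(t * τ) * Real.exp (max lam 0 * t)) ^ 2 =
        4 * L ^ 2 * (t * τ) * Real.exp (max lam 0 * t) ^ 2 := by
      rw [mul_pow, mul_pow, Real.sq_sqrt ht]
      ring
    rw [e, e, ← hsq] at h
    linarith [mul_nonneg ha hb]
  have h2 : 2 * L * √(t * τ) * Real.exp (max lam 0 * t) ≤
      8 * L * √(t * τ) * (1 + |lam| * √(t * τ)) * Real.exp (max lam 0 * t) := by
    have h3 : 0 ≤ |lam| * √(t * τ) := by positivity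
    have h4 : 0 ≤ L * √(t * τ) := by positivity
    refine mul_le_mul_of_nonneg_right ?_ (Real.exp_pos _).le
    linarith [mul_nonneg h4 h3]
  linarith
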